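/- Let $m\in C^2([0,1])$ and $V\in C([0,1])$ be real-valued, and suppose that $m'(x)>0$ for all $x\in(0,1)$ (so that $m'(0)=0$ and $m'(1)=0$ are allowed). For $D>0$ let $\lambda(D)$ denote the principal eigenvalue of $$-D\varphi''-m'(x)\varphi'+V(x)\varphi=\lambda(D)\varphi\ \text{ in }(0,1),\qquad \varphi'(0)=\varphi'(1)=0,$$ that is, the unique real number for which this problem has a solution $\varphi\in C^2([0,1])$ that is positive on $[0,1]$ (such a number exists for every $D>0$). Then $$\lim_{D\to0^+}\lambda(D)=\min\left\{V(0)+[m'']_+(0),\ V(1)\right\},$$ where $[a]_+=\max\{a,0\}$, and where $m''(0)$ is the one-sided second derivative of $m$ at $0$ if $m'(0)=0$, while by convention $m''(0)=+\infty$ if $m'(0)>0$ (so that the limit is then $V(1)$). -/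

import Mathlib

open Set Filter Topology

/-- The derivative of a function on `[0,1]`: two-sided at interior points, one-sided at `0` and
at `1`. -/
noncomputable def derivUnit (f : ℝ → ℝ) : ℝ → ℝ :=
  derivWithin f (Icc (0 : ℝ) 1)

/-- `φ ∈ C²([0,1])` is a positive (classical) eigenfunction, with eigenvalue `μ`, of
`-D φ'' - m' φ' + V φ = μ φ` in `(0,1)`, `φ'(0) = φ'(1) = 0`. -/
structure IsPositiveEigenfunction (m V : ℝ → ℝ) (D μ : ℝ) (φ : ℝ → ℝ) : Prop where
  contDiffOn : ContDiffOn ℝ 2 φ (Icc (0 : ℝ) 1)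
  pos : ∀ x ∈ Icc (0 : ℝ) 1, 0 < φ x
  equation : ∀ x ∈ Ioo (0 : ℝ) 1,
    -D * derivUnit (derivUnit φ) x - derivUnit m x * derivUnit φ x + V x * φ x = μ * φ x
  neumann_zero : derivUnit φ 0 = 0
  neumann_one : derivUnit φ 1 = 0

/-- `μ` is the principal eigenvalue of
`-D φ'' - m' φ' + V φ = μ φ` in `(0,1)`, `φ'(0) = φ'(1) = 0`:
the real eigenvalue that has a positive eigenfunction. -/
def IsPrincipalEigenvalue (m V : ℝ → ℝ) (D μ : ℝ) : Prop :=
  ∃ φ : ℝ → ℝ, IsPositiveEigenfunction m V D μ φ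

open Classical in
/-- The extended value of `m''(0)`: it is `+∞` if `m'(0) > 0`, `-∞` if `m'(0) < 0`, and the
ordinary (one-sided) second derivative `m''(0)` if `m'(0) = 0`. -/
noncomputable def secondDerivAtZero (m : ℝ → ℝ) : EReal :=
  if 0 < derivUnit m 0 then ⊤
  else if derivUnit m 0 < 0 then ⊥
  else ((derivUnit (derivUnit m) 0 : ℝ) : EReal)

/-- The positive part `[a]₊ = max {a, 0}` of an extended real. -/
noncomputable def erealPosPart (a : EReal) : EReal :=
  max a 0

/-!
The logarithmic derivative `u = φ' / φ` of a positive eigenfunction solves the Riccati problem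
`D (u' + u²) + m' u = V - μ`, `u(0) = u(1) = 0`, and conversely. Two solutions with distinct `μ`
would separate at `0` and could never meet again, so `μ` is unique; it exists by shooting with the
Prüfer angle `arctan u`.

As `D → 0`, both bounds come from comparing `u` with barriers. If `μ` stays above `V 1`, or above
`V 0 + β` with `m'(x) ≤ β x` near `0`, then on a fixed interval `-u`, respectively `-u - β x / D`,
satisfies `D G' ≥ e + D G²` with `e > 0`, hence blows up once `D` is small. If `μ ≤ a`, where `a`
is less than `V 1` and than `V 0 + α` with `m'(x) ≥ α x` near `0`, then the barrier
`-p B x / (D + B x²)` bounds `u(δ)` below by a constant independent of `D`, whereas the barrier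
`-K (1 - x)` with `K` large forces `u(δ)` below that constant: a contradiction.
-/

section Barriers

variable {f f' : ℝ → ℝ} {a b : ℝ}

lemma deriv_nonpos_of_forall_right_le {c : ℝ} (hab : a < b)
    (hf : HasDerivWithinAt f c (Icc a b) b) (hmin : ∀ x ∈ Icc a b, f b ≤ f x) : c ≤ 0 := by
  have hslope : Tendsto (slope f b) (𝓝[<] b) (𝓝 c) := by
    rw [← nhdsWithin_Ico_eq_nhdsLT hab]
    exact (hasDerivWithinAt_iff_tendsto_slope.1 hf).mono_left
      (nhdsWithin_mono _ fun x hx => ⟨Ico_subset_Icc_self hx, hx.2.ne⟩)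
  refine le_of_tendsto hslope ?_
  filter_upwards [Ico_mem_nhdsLT hab] with x hx
  rw [slope_def_field]
  exact div_nonpos_of_nonneg_of_nonpos (sub_nonneg.2 (hmin x (Ico_subset_Icc_self hx)))
    (sub_nonpos.2 hx.2.le)

lemma pos_of_deriv_pos_at_zeros
    (hf : ∀ x ∈ Icc a b, HasDerivWithinAt f (f' x) (Icc a b) x)
    (hpos : ∀ x ∈ Icc a b, f x = 0 → 0 < f' x) (ha : 0 ≤ f a) :
    ∀ x ∈ Ioc a b, 0 < f x := by
  have hnonneg : ∀ x ∈ Icc a b, 0 ≤ f x := by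
    refine image_le_of_deriv_right_lt_deriv_boundary' (f := fun _ => 0) (f' := fun _ => 0)
      continuousOn_const (fun x _ => hasDerivWithinAt_const x _ 0) ha
      (fun x hx => (hf x hx).continuousWithinAt)
      (fun x hx => (hf x (Ico_subset_Icc_self hx)).mono_of_mem_nhdsWithin
        (Icc_mem_nhdsGE_of_mem hx))
      (fun x hx hx0 => hpos x (Ico_subset_Icc_self hx) hx0.symm)
  intro x hx
  have hxI := Ioc_subset_Icc_self hx
  refine (hnonneg x hxI).lt_of_ne' fun hx0 => (hpos x hxI hx0).not_ge ?_
  have hsub : Icc a x ⊆ Icc a b := Icc_subset_Icc_right hx.2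
  exact deriv_nonpos_of_forall_right_le hx.1 ((hf x hxI).mono hsub)
    fun y hy => hx0 ▸ hnonneg y (hsub hy)

lemma neg_of_deriv_pos_at_zeros
    (hf : ∀ x ∈ Icc a b, HasDerivWithinAt f (f' x) (Icc a b) x)
    (hpos : ∀ x ∈ Icc a b, f x = 0 → 0 < f' x) (hb : f b ≤ 0) :
    ∀ x ∈ Ico a b, f x < 0 := by
  have hmaps : MapsTo Neg.neg (Icc (-b) (-a)) (Icc a b) := fun x hx =>
    ⟨by linarith [hx.2], by linarith [hx.1]⟩
  have hreflect : ∀ x ∈ Icc (-b) (-a),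
      HasDerivWithinAt (fun y => -f (-y)) (f' (-x)) (Icc (-b) (-a)) x := fun x hx => by
    simpa using
      ((hf (-x) (hmaps hx)).scomp x (hasDerivAt_neg x).hasDerivWithinAt hmaps).fun_neg
  intro x hx
  have := pos_of_deriv_pos_at_zeros hreflect
    (fun y hy hy0 => hpos (-y) (hmaps hy) (neg_eq_zero.1 hy0)) (by simpa using hb) (-x)
    ⟨neg_lt_neg hx.2, neg_le_neg hx.1⟩
  simpa using this

lemma mul_sq_lt_of_riccati_le {D e : ℝ} (hab : a ≤ b) (hD : 0 < D) (he : 0 < e)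
    (hf : ∀ x ∈ Icc a b, HasDerivWithinAt f (f' x) (Icc a b) x)
    (hriccati : ∀ x ∈ Icc a b, e + D * f x ^ 2 ≤ D * f' x) :
    e * (b - a) ^ 2 < Real.pi ^ 2 * D := by
  obtain ⟨s, hs, hsq⟩ : ∃ s > 0, D * s ^ 2 = e :=
    ⟨√(e / D), Real.sqrt_pos.2 (div_pos he hD), by
      rw [Real.sq_sqrt (div_pos he hD).le, mul_div_cancel₀ _ hD.ne']⟩
  have harctan : ∀ x ∈ Icc a b, HasDerivWithinAt (fun y => Real.arctan (f y / s) - s * y)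
      (1 / (1 + (f x / s) ^ 2) * (f' x / s) - s * 1) (Icc a b) x := fun x hx =>
    ((hf x hx).div_const s).arctan.sub ((hasDerivWithinAt_id x _).const_mul s)
  have hmono : MonotoneOn (fun y => Real.arctan (f y / s) - s * y) (Icc a b) := by
    refine monotoneOn_of_hasDerivWithinAt_nonneg (convex_Icc a b)
      (fun x hx => (harctan x hx).continuousWithinAt)
      (fun x hx => (harctan x (interior_subset hx)).mono interior_subset) fun x hx => ?_
    have hx' : s ^ 2 + f x ^ 2 ≤ f' x := by
      refine le_of_mul_le_mul_left ?_ hD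
      linarith [hriccati x (interior_subset hx)]
    have : 1 / (1 + (f x / s) ^ 2) * (f' x / s) - s * 1
        = s * (f' x - (s ^ 2 + f x ^ 2)) / (s ^ 2 + f x ^ 2) := by
      field_simp
    rw [this]
    have := sub_nonneg.2 hx'
    positivity
  have hlt : s * (b - a) < Real.pi := by
    have := hmono (left_mem_Icc.2 hab) (right_mem_Icc.2 hab) hab
    have := Real.arctan_lt_pi_div_two (f b / s)
    have := Real.neg_pi_div_two_lt_arctan (f a / s)
    linarith
  calc e * (b - a) ^ 2 = D * (s * (b - a)) ^ 2 := by rw [← hsq]; ring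
    _ < D * Real.pi ^ 2 := by
      gcongr
    _ = Real.pi ^ 2 * D := mul_comm _ _

end Barriers

lemma eventually_forall_add_mul_pos_of_isCompact {X : Type*} [TopologicalSpace X] {s : Set X}
    {h P : X → ℝ} (hs : IsCompact s)
    (hh : ContinuousOn h s) (hP : ContinuousOn P s) (hP_nonneg : ∀ x ∈ s, 0 ≤ P x)
    (hpos : ∀ x ∈ s, P x = 0 → 0 < h x) :
    ∀ᶠ K in atTop, ∀ x ∈ s, 0 < h x + K * P x := by
  have hlocal : ∀ x ∈ s, ∃ t ∈ 𝓝[s] x, ∀ᶠ K : ℝ in atTop, ∀ y ∈ t, y ∈ s → 0 < h y + K * P y := by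
    intro x hx
    obtain ⟨K₀, hK₀⟩ : ∃ K₀, 0 < h x + K₀ * P x := by
      rcases (hP_nonneg x hx).eq_or_lt with h0 | h0
      · exact ⟨0, by simpa using hpos x hx h0.symm⟩
      · exact ⟨(1 - h x) / P x, by rw [div_mul_cancel₀ _ h0.ne']; linarith⟩
    have hnear : ∀ᶠ y in 𝓝[s] x, 0 < h y + K₀ * P y :=
      ((hh x hx).add (continuousWithinAt_const.mul (hP x hx))).eventually (lt_mem_nhds hK₀)
    refine ⟨_, hnear, ?_⟩
    filter_upwards [eventually_ge_atTop K₀] with K hK y hy hys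
    have := mul_le_mul_of_nonneg_right hK (hP_nonneg y hys)
    exact lt_of_lt_of_le hy (by linarith)
  have := hs.induction_on (p := fun t => ∀ᶠ K : ℝ in atTop, ∀ y ∈ t, y ∈ s → 0 < h y + K * P y)
    (by simp) (fun t t' htt' h' => h'.mono fun K hK y hy => hK y (htt' hy))
    (fun t t' h₁ h₂ => by
      filter_upwards [h₁, h₂] with K h₁ h₂ y hy using hy.elim (h₁ y) (h₂ y)) hlocal
  exact this.mono fun K hK x hx => hK x hx hx

lemma nonneg_on_Icc_of_nonneg_on_Ioo {f : ℝ → ℝ} {a b : ℝ} (hab : a < b)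
    (hf : ContinuousOn f (Icc a b)) (hnonneg : ∀ x ∈ Ioo a b, 0 ≤ f x) :
    ∀ x ∈ Icc a b, 0 ≤ f x := by
  rw [← closure_Ioo hab.ne] at hf ⊢
  exact fun x hx => le_on_closure hnonneg continuousOn_const hf hx

section ODE

open scoped NNReal

variable {E : Type*} [NormedAddCommGroup E] [NormedSpace ℝ E] {a b : ℝ}

lemma exists_hasDerivWithinAt_Icc_of_lipschitzWith_of_bounded [CompleteSpace E] {v : ℝ → E → E}
    {K L : ℝ≥0} (hab : a ≤ b)
    (hlip : ∀ t ∈ Icc a b, LipschitzWith K (v t))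
    (hcont : ∀ y, ContinuousOn (v · y) (Icc a b)) (hbound : ∀ t ∈ Icc a b, ∀ y, ‖v t y‖ ≤ L)
    (x₀ : E) :
    ∃ α : ℝ → E, α a = x₀ ∧ ∀ t ∈ Icc a b, HasDerivWithinAt α (v t (α t)) (Icc a b) t := by
  have hpicard : IsPicardLindelof v (⟨a, left_mem_Icc.2 hab⟩ : Icc a b) x₀
      (L * (b - a).toNNReal) 0 L K :=
    { lipschitzOnWith := fun t ht => (hlip t ht).lipschitzOnWith
      continuousOn := fun y _ => hcont y
      norm_le := fun t ht y _ => hbound t ht y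
      mul_max_le := by simp [hab] }
  exact hpicard.exists_eq_forall_mem_Icc_hasDerivWithinAt₀

lemma continuous_of_forall_hasDerivWithinAt_Icc {M : Type*} [PseudoMetricSpace M]
    {v : M → ℝ → E → E} {x : M → ℝ → E} {K : M → ℝ≥0} {C : ℝ≥0} {x₀ : E}
    (hlip : ∀ μ, ∀ t ∈ Icc a b, LipschitzWith (K μ) (v μ t))
    (hparam : ∀ μ ν, ∀ t ∈ Icc a b, ∀ y, dist (v μ t y) (v ν t y) ≤ C * dist μ ν)
    (hx : ∀ μ, ∀ t ∈ Icc a b, HasDerivWithinAt (x μ) (v μ t (x μ t)) (Icc a b) t)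
    (hx₀ : ∀ μ, x μ a = x₀) {t : ℝ} (ht : t ∈ Icc a b) : Continuous fun μ => x μ t := by
  have hright : ∀ μ, ∀ s ∈ Ico a b, HasDerivWithinAt (x μ) (v μ s (x μ s)) (Ici s) s :=
    fun μ s hs => (hx μ s (Ico_subset_Icc_self hs)).mono_of_mem_nhdsWithin
      (Icc_mem_nhdsGE_of_mem hs)
  have hcont : ∀ μ, ContinuousOn (x μ) (Icc a b) := fun μ s hs => (hx μ s hs).continuousWithinAt
  have hgronwall : ∀ μ ν, dist (x μ t) (x ν t) ≤ gronwallBound 0 (K ν) (C * dist μ ν) (t - a) := by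
    intro μ ν
    simpa using dist_le_of_approx_trajectories_ODE_of_mem (s := fun _ => univ) (εf := C * dist μ ν)
      (εg := 0) (δ := 0)
      (fun s hs => (hlip ν s (Ico_subset_Icc_self hs)).lipschitzOnWith)
      (hcont μ) (hright μ) (fun s hs => hparam μ ν s (Ico_subset_Icc_self hs) _)
      (fun _ _ => mem_univ _) (hcont ν) (hright ν) (fun s _ => (dist_self _).le)
      (fun _ _ => mem_univ _) (by simp [hx₀]) t ht
  refine continuous_iff_continuousAt.2 fun ν => tendsto_iff_dist_tendsto_zero.2 ?_
  refine squeeze_zero (fun _ => dist_nonneg) (fun μ => hgronwall μ ν) ?_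
  have hbound : Continuous fun μ => gronwallBound 0 (K ν) (C * dist μ ν) (t - a) :=
    (gronwallBound_continuous_ε 0 (K ν) (t - a)).comp (by fun_prop)
  simpa [gronwallBound_ε0_δ0] using hbound.tendsto ν

lemma exists_hasDerivWithinAt_Icc_of_continuousOn [CompleteSpace E] {w : ℝ → E}
    (hab : a ≤ b) (hw : ContinuousOn w (Icc a b)) :
    ∃ W : ℝ → E, ∀ t ∈ Icc a b, HasDerivWithinAt W (w t) (Icc a b) t := by
  obtain ⟨L, hL⟩ := isCompact_Icc.exists_bound_of_continuousOn hw
  obtain ⟨W, -, hW⟩ := exists_hasDerivWithinAt_Icc_of_lipschitzWith_of_bounded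
    (v := fun t _ => w t) (K := 0) (L := L.toNNReal) hab
    (fun t _ => LipschitzWith.const (w t)) (fun _ => hw)
    (fun t ht _ => (hL t ht).trans (Real.le_coe_toNNReal L)) 0
  exact ⟨W, hW⟩

end ODE

/-- The function `p B x / (D + B x²)`, which is minus the logarithmic derivative of
`(D + B x²) ^ (-p / 2)`; its negative is a lower barrier for `u = φ' / φ` near `0`. -/
noncomputable def innerBarrier (D p B x : ℝ) : ℝ :=
  p * B * x / (D + B * x ^ 2)

section InnerBarrier

variable {D p B : ℝ}

lemma hasDerivAt_innerBarrier (p : ℝ) (hD : 0 < D) (hB : 0 ≤ B) (x : ℝ) :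
    HasDerivAt (innerBarrier D p B) (p * B * (D - B * x ^ 2) / (D + B * x ^ 2) ^ 2) x := by
  have hden : D + B * x ^ 2 ≠ 0 := by positivity
  refine (((hasDerivAt_id' x).const_mul (p * B)).div
    (((hasDerivAt_pow 2 x).const_mul B).const_add D) hden).congr_deriv ?_
  push_cast
  ring

lemma mul_le_riccati_innerBarrier (hD : 0 < D) (hp : 0 ≤ p) (hB : 0 ≤ B) (x : ℝ) :
    p * B ≤ (p + 3) * B * x * innerBarrier D p B x - D * innerBarrier D p B x ^ 2
      + D * (p * B * (D - B * x ^ 2) / (D + B * x ^ 2) ^ 2) := by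
  have hgap : 0 ≤ p * B * ((p + 2) * (B * x ^ 2) ^ 2) / (D + B * x ^ 2) ^ 2 := by positivity
  calc p * B ≤ p * B + p * B * ((p + 2) * (B * x ^ 2) ^ 2) / (D + B * x ^ 2) ^ 2 := by linarith
    _ = _ := by
      unfold innerBarrier
      field_simp
      ring

lemma innerBarrier_nonneg {x : ℝ} (hD : 0 < D) (hp : 0 ≤ p) (hB : 0 ≤ B) (hx : 0 ≤ x) :
    0 ≤ innerBarrier D p B x := by
  unfold innerBarrier
  positivity

lemma innerBarrier_le_div {x : ℝ} (hD : 0 < D) (hp : 0 ≤ p) (hB : 0 ≤ B) (hx : 0 < x) :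
    innerBarrier D p B x ≤ p / x := by
  rw [innerBarrier, div_le_div_iff₀ (by positivity) hx]
  linarith [mul_nonneg hp hD.le]

end InnerBarrier

/-- `u` solves on `[0,1]` the Riccati boundary value problem
`D (u' + u²) + b u = V - μ`, `u(0) = u(1) = 0`, which the logarithmic derivative `u = φ' / φ` of a
positive eigenfunction `φ` with eigenvalue `μ` satisfies for `b = m'`. -/
structure IsRiccatiSolution (b V : ℝ → ℝ) (D μ : ℝ) (u : ℝ → ℝ) : Prop where
  hasDerivWithinAt : ∀ x ∈ Icc (0 : ℝ) 1,
    HasDerivWithinAt u ((V x - μ - b x * u x) / D - u x ^ 2) (Icc 0 1) x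
  zero : u 0 = 0
  one : u 1 = 0

namespace IsRiccatiSolution

variable {b V u : ℝ → ℝ} {D μ : ℝ}

lemma eigenvalue_unique {v : ℝ → ℝ} {ν : ℝ} (hD : 0 < D) (hu : IsRiccatiSolution b V D μ u)
    (hv : IsRiccatiSolution b V D ν v) : μ = ν := by
  wlog hμν : μ < ν generalizing u v μ ν
  · exact (not_lt.1 hμν).antisymm' (not_lt.1 fun h => h.ne (this hv hu h))
  have hpos := pos_of_deriv_pos_at_zeros (f := fun x => u x - v x)
    (fun x hx => (hu.hasDerivWithinAt x hx).sub (hv.hasDerivWithinAt x hx))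
    (fun x _ hx0 => ?_) (by simp [hu.zero, hv.zero]) 1 ⟨one_pos, le_rfl⟩
  · simp [hu.one, hv.one] at hpos
  · rw [sub_eq_zero.1 hx0]
    have : 0 < (ν - μ) / D := div_pos (sub_pos.2 hμν) hD
    calc 0 < (ν - μ) / D := this
      _ = _ := by ring

lemma eigenvalue_lt_of_le_near_one {c v e : ℝ} (hu : IsRiccatiSolution b V D μ u) (hD : 0 < D)
    (hc : c ∈ Ico (0 : ℝ) 1) (he : 0 < e) (hb : ∀ x ∈ Icc c 1, 0 ≤ b x)
    (hV : ∀ x ∈ Icc c 1, V x ≤ v) (hsmall : Real.pi ^ 2 * D ≤ e * (1 - c) ^ 2) :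
    μ < v + e := by
  by_contra! hμ
  have hsub : Icc c 1 ⊆ Icc (0 : ℝ) 1 := Icc_subset_Icc_left hc.1
  have hneg : ∀ x ∈ Icc c 1,
      HasDerivWithinAt (fun y => -u y) (-((V x - μ - b x * u x) / D - u x ^ 2)) (Icc c 1) x :=
    fun x hx => ((hu.hasDerivWithinAt x (hsub hx)).mono hsub).fun_neg
  have hu_nonneg : ∀ x ∈ Icc c 1, 0 ≤ u x := by
    intro x hx
    rcases hx.2.eq_or_lt with rfl | hx1
    · exact hu.one.ge
    refine (neg_neg_iff_pos.1 (neg_of_deriv_pos_at_zeros hneg (fun y hy hy0 => ?_)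
      (by simp [hu.one]) x ⟨hx.1, hx1⟩)).le
    rw [neg_eq_zero.1 hy0]
    have : 0 < (μ - V y) / D := div_pos (by linarith [hV y hy]) hD
    calc 0 < (μ - V y) / D := this
      _ = _ := by ring
  refine (mul_sq_lt_of_riccati_le hc.2.le hD he hneg fun x hx => ?_).not_ge hsmall
  have hbu := mul_nonneg (hb x hx) (hu_nonneg x hx)
  calc e + D * (-u x) ^ 2 ≤ μ - V x + b x * u x + D * u x ^ 2 := by linarith [hV x hx]
    _ = D * -((V x - μ - b x * u x) / D - u x ^ 2) := by field_simp; ring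

lemma eigenvalue_lt_of_le_near_zero {β δ v e : ℝ} (hu : IsRiccatiSolution b V D μ u)
    (hD : 0 < D) (hδ : δ ∈ Ioc (0 : ℝ) 1) (he : 0 < e) (hβ : 0 ≤ β)
    (hb : ∀ x ∈ Icc 0 δ, b x ≤ β * x) (hV : ∀ x ∈ Icc 0 δ, V x ≤ v)
    (hsmall : Real.pi ^ 2 * D ≤ e * δ ^ 2) :
    μ < v + β + e := by
  by_contra! hμ
  have hsub : Icc 0 δ ⊆ Icc (0 : ℝ) 1 := Icc_subset_Icc_right hδ.2
  -- The shift by `β x / D` absorbs the drift, because `b u ≥ β x u` where `u ≤ 0`.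
  have hderiv : ∀ x ∈ Icc 0 δ, HasDerivWithinAt (fun y => -u y - β / D * y)
      (-((V x - μ - b x * u x) / D - u x ^ 2) - β / D * 1) (Icc 0 δ) x := fun x hx =>
    ((hu.hasDerivWithinAt x (hsub hx)).mono hsub).fun_neg.sub
      ((hasDerivWithinAt_id x _).const_mul _)
  have hriccati : ∀ x ∈ Icc 0 δ, 0 ≤ -u x - β / D * x →
      e + D * (-u x - β / D * x) ^ 2
        ≤ D * (-((V x - μ - b x * u x) / D - u x ^ 2) - β / D * 1) := by
    intro x hx hG
    have hβx : 0 ≤ β / D * x := mul_nonneg (div_nonneg hβ hD.le) hx.1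
    have hbu : 0 ≤ (β * x - b x) * -u x :=
      mul_nonneg (sub_nonneg.2 (hb x hx)) (by linarith)
    have hG' : 0 ≤ β * x * (-u x - β / D * x) := mul_nonneg (mul_nonneg hβ hx.1) hG
    calc e + D * (-u x - β / D * x) ^ 2
        ≤ μ - V x - β + D * (-u x - β / D * x) ^ 2 + (β * x - b x) * -u x
          + β * x * (-u x - β / D * x) := by linarith [hV x hx]
      _ = D * (-((V x - μ - b x * u x) / D - u x ^ 2) - β / D * 1) := by field_simp; ring
  have hnonneg : ∀ x ∈ Icc 0 δ, 0 ≤ -u x - β / D * x := by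
    intro x hx
    rcases hx.1.eq_or_lt with rfl | hx0
    · simp [hu.zero]
    refine (pos_of_deriv_pos_at_zeros hderiv (fun y hy hy0 => ?_) (by simp [hu.zero]) x
      ⟨hx0, hx.2⟩).le
    have := hriccati y hy hy0.ge
    rw [hy0] at this
    exact pos_of_mul_pos_right (by linarith) hD.le
  refine (mul_sq_lt_of_riccati_le hδ.1.le hD he hderiv
    fun x hx => hriccati x hx (hnonneg x hx)).not_ge ?_
  simpa using hsmall

lemma apply_lt_of_lt_potential {δ K : ℝ} (hu : IsRiccatiSolution b V D μ u) (hD : 0 < D)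
    (hδ : δ ∈ Ico (0 : ℝ) 1)
    (hμ : ∀ x ∈ Icc δ 1, D * K + D * K ^ 2 < V x - μ + K * (b x * (1 - x))) :
    u δ < -K * (1 - δ) := by
  have hsub : Icc δ 1 ⊆ Icc (0 : ℝ) 1 := Icc_subset_Icc_left hδ.1
  have hneg := neg_of_deriv_pos_at_zeros (f := fun y => u y + K * (1 - y))
    (fun x hx => ((hu.hasDerivWithinAt x (hsub hx)).mono hsub).add
      (((hasDerivWithinAt_id x _).const_sub 1).const_mul K))
    (fun x hx hx0 => ?_) (by simp [hu.one]) δ ⟨le_rfl, hδ.2⟩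
  · linarith
  have hux : u x = -K * (1 - x) := by linarith
  have hx1 : K ^ 2 * (1 - x) ^ 2 ≤ K ^ 2 * 1 := by
    gcongr
    nlinarith [hx.1, hx.2, hδ.1]
  have hpos : 0 < V x - μ + K * (b x * (1 - x)) - D * K - D * K ^ 2 := by linarith [hμ x hx]
  calc 0 < (V x - μ + K * (b x * (1 - x)) - D * K - D * K ^ 2) / D := div_pos hpos hD
    _ = (V x - μ + K * (b x * (1 - x))) / D - K - K ^ 2 * 1 := by field_simp
    _ ≤ (V x - μ + K * (b x * (1 - x))) / D - K - K ^ 2 * (1 - x) ^ 2 := by gcongr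
    _ = (V x - μ - b x * u x) / D - u x ^ 2 + K * -1 := by rw [hux]; ring

lemma neg_div_le_apply_of_le_drift {δ p B : ℝ} (hu : IsRiccatiSolution b V D μ u)
    (hD : 0 < D) (hδ : δ ∈ Ioc (0 : ℝ) 1) (hp : 0 ≤ p) (hB : 0 ≤ B)
    (hb : ∀ x ∈ Icc 0 δ, (p + 3) * B * x ≤ b x) (hμ : ∀ x ∈ Icc 0 δ, μ < V x + p * B) :
    -(p / δ) ≤ u δ := by
  have hsub : Icc 0 δ ⊆ Icc (0 : ℝ) 1 := Icc_subset_Icc_right hδ.2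
  by_contra! hlt
  have hneg := neg_of_deriv_pos_at_zeros (f := fun y => u y + innerBarrier D p B y)
    (fun x hx => ((hu.hasDerivWithinAt x (hsub hx)).mono hsub).add
      (hasDerivAt_innerBarrier p hD hB x).hasDerivWithinAt)
    (fun x hx hx0 => ?_) ?_ 0 ⟨le_rfl, hδ.1⟩
  · simp [hu.zero, innerBarrier] at hneg
  · have hbg := mul_le_mul_of_nonneg_right (hb x hx) (innerBarrier_nonneg hD hp hB hx.1)
    have hriccati := mul_le_riccati_innerBarrier hD hp hB x
    rw [eq_neg_of_add_eq_zero_left hx0]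
    set g := innerBarrier D p B x
    set g' := p * B * (D - B * x ^ 2) / (D + B * x ^ 2) ^ 2
    refine pos_of_mul_pos_right (a := D) ?_ hD.le
    calc 0 < V x - μ + b x * g - D * g ^ 2 + D * g' := by linarith [hμ x hx]
      _ = D * ((V x - μ - b x * -g) / D - (-g) ^ 2 + g') := by field_simp; ring
  · linarith [innerBarrier_le_div hD hp hB hδ.1]

end IsRiccatiSolution

section Thresholds

lemma eventually_mul_lt_nhdsGT_zero (c : ℝ) {k : ℝ} (hk : 0 < k) :
    ∀ᶠ D in 𝓝[>] (0 : ℝ), c * D < k :=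
  (((continuous_const_mul c).tendsto' 0 0 (mul_zero c)).mono_left
    nhdsWithin_le_nhds).eventually_lt_const hk

lemma exists_forall_Icc_left_of_eventually {P : ℝ → Prop} {a b : ℝ} (hab : a < b)
    (h : ∀ᶠ x in 𝓝[Icc a b] a, P x) : ∃ c ∈ Ioo a b, ∀ x ∈ Icc a c, P x := by
  rw [nhdsWithin_Icc_eq_nhdsGE hab] at h
  obtain ⟨c, hac, hc⟩ := mem_nhdsGE_iff_exists_Icc_subset.1
    (h.and (mem_of_superset (Ico_mem_nhdsGE hab) fun x hx => hx.2))
  exact ⟨c, ⟨hac, (hc (right_mem_Icc.2 hac.le)).2⟩, fun x hx => (hc hx).1⟩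

lemma exists_forall_Icc_right_of_eventually {P : ℝ → Prop} {a b : ℝ} (hab : a < b)
    (h : ∀ᶠ x in 𝓝[Icc a b] b, P x) : ∃ c ∈ Ioo a b, ∀ x ∈ Icc c b, P x := by
  rw [nhdsWithin_Icc_eq_nhdsLE hab] at h
  obtain ⟨c, hcb, hc⟩ := mem_nhdsLE_iff_exists_Icc_subset.1
    (h.and (mem_of_superset (Ioc_mem_nhdsLE hab) fun x hx => hx.1))
  exact ⟨c, ⟨(hc (left_mem_Icc.2 hcb.le)).2, hcb⟩, fun x hx => (hc hx).1⟩

variable {b V : ℝ → ℝ} {a : ℝ}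

lemma eventually_eigenvalue_lt_of_potential_one_lt (hV : ContinuousWithinAt V (Icc 0 1) 1)
    (hb : ∀ x ∈ Icc (0 : ℝ) 1, 0 ≤ b x) (ha : V 1 < a) :
    ∀ᶠ D in 𝓝[>] (0 : ℝ), ∀ μ u, IsRiccatiSolution b V D μ u → μ < a := by
  obtain ⟨v, hv, hva⟩ := exists_between ha
  obtain ⟨c, hc, hVc⟩ :=
    exists_forall_Icc_right_of_eventually one_pos (hV.eventually_lt_const hv)
  have hk : 0 < (a - v) * (1 - c) ^ 2 := by
    have := sub_pos.2 hva
    have := sub_pos.2 hc.2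
    positivity
  filter_upwards [self_mem_nhdsWithin, eventually_mul_lt_nhdsGT_zero (Real.pi ^ 2) hk]
    with D hD hsmall μ u hu
  simpa using hu.eigenvalue_lt_of_le_near_one hD ⟨hc.1.le, hc.2⟩ (sub_pos.2 hva)
    (fun x hx => hb x ⟨hc.1.le.trans hx.1, hx.2⟩) (fun x hx => (hVc x hx).le) hsmall.le

lemma eventually_eigenvalue_lt_of_drift_le {β : ℝ} (hV : ContinuousWithinAt V (Icc 0 1) 0)
    (hβ : 0 ≤ β) (hb : ∀ᶠ x in 𝓝[Icc 0 1] (0 : ℝ), b x ≤ β * x) (ha : V 0 + β < a) :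
    ∀ᶠ D in 𝓝[>] (0 : ℝ), ∀ μ u, IsRiccatiSolution b V D μ u → μ < a := by
  obtain ⟨v, hv, hva⟩ := exists_between (lt_sub_iff_add_lt.2 ha)
  obtain ⟨δ, hδ, hδ'⟩ :=
    exists_forall_Icc_left_of_eventually one_pos (hb.and (hV.eventually_lt_const hv))
  have he : 0 < a - (v + β) := by linarith
  filter_upwards [self_mem_nhdsWithin, eventually_mul_lt_nhdsGT_zero (Real.pi ^ 2)
    (mul_pos he (pow_pos hδ.1 2))] with D hD hsmall μ u hu
  simpa using hu.eigenvalue_lt_of_le_near_zero hD ⟨hδ.1, hδ.2.le⟩ he hβ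
    (fun x hx => (hδ' x hx).1) (fun x hx => (hδ' x hx).2.le) hsmall.le

lemma exists_le_apply_of_le_drift {α : ℝ} (hV : ContinuousWithinAt V (Icc 0 1) 0)
    (hα : 0 ≤ α) (hb : ∀ᶠ x in 𝓝[Icc 0 1] (0 : ℝ), α * x ≤ b x) (ha : a < V 0 + α) :
    ∃ δ ∈ Ioo (0 : ℝ) 1, ∃ C, ∀ D > 0, ∀ μ ≤ a, ∀ u, IsRiccatiSolution b V D μ u → C ≤ u δ := by
  obtain ⟨p, hp, hpa⟩ : ∃ p, 0 ≤ p ∧ a < V 0 + p * (α / (p + 3)) := by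
    have hgap : 0 < V 0 + α - a := sub_pos.2 ha
    have hp : 0 ≤ 3 * α / (V 0 + α - a) := by positivity
    refine ⟨3 * α / (V 0 + α - a), hp, ?_⟩
    have : 3 * α / (3 * α / (V 0 + α - a) + 3) < V 0 + α - a := by
      rw [div_lt_iff₀ (by positivity), mul_add, mul_div_cancel₀ _ hgap.ne']
      linarith
    calc a < V 0 + α - 3 * α / (3 * α / (V 0 + α - a) + 3) := by linarith
      _ = _ := by field_simp; ring
  obtain ⟨δ, hδ, hδ'⟩ := exists_forall_Icc_left_of_eventually one_pos
    (hb.and ((hV.add continuousWithinAt_const).eventually_const_lt hpa))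
  refine ⟨δ, hδ, -(p / δ), fun D hD μ hμ u hu => ?_⟩
  refine hu.neg_div_le_apply_of_le_drift hD ⟨hδ.1, hδ.2.le⟩ hp (B := α / (p + 3))
    (by positivity) (fun x hx => ?_) fun x hx => hμ.trans_lt (hδ' x hx).2
  rw [mul_div_cancel₀ _ (by positivity)]
  exact (hδ' x hx).1

lemma eventually_apply_lt_of_lt_potential_one (hb : ContinuousOn b (Icc 0 1))
    (hV : ContinuousOn V (Icc 0 1)) (hb_pos : ∀ x ∈ Ioo (0 : ℝ) 1, 0 < b x) (ha : a < V 1)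
    {δ : ℝ} (hδ : δ ∈ Ioo (0 : ℝ) 1) (C : ℝ) :
    ∀ᶠ D in 𝓝[>] (0 : ℝ), ∀ μ ≤ a, ∀ u, IsRiccatiSolution b V D μ u → u δ < C := by
  have hsub : Icc δ 1 ⊆ Icc (0 : ℝ) 1 := Icc_subset_Icc_left hδ.1.le
  have hh : ContinuousOn (fun x => V x - a) (Icc δ 1) := (hV.mono hsub).sub continuousOn_const
  have hP : ContinuousOn (fun x => b x * (1 - x)) (Icc δ 1) := (hb.mono hsub).mul (by fun_prop)
  have hP_pos : ∀ x ∈ Icc δ 1, x ≠ 1 → 0 < b x * (1 - x) := fun x hx hx1 =>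
    mul_pos (hb_pos x ⟨hδ.1.trans_le hx.1, hx.2.lt_of_ne hx1⟩) (sub_pos.2 (hx.2.lt_of_ne hx1))
  have hP_nonneg : ∀ x ∈ Icc δ 1, 0 ≤ b x * (1 - x) := fun x hx => by
    rcases eq_or_ne x 1 with rfl | hx1
    · simp
    · exact (hP_pos x hx hx1).le
  have hpos_of_zero : ∀ x ∈ Icc δ 1, b x * (1 - x) = 0 → 0 < V x - a := fun x hx hx0 => by
    rcases eq_or_ne x 1 with rfl | hx1
    · exact sub_pos.2 ha
    · exact absurd hx0 (hP_pos x hx hx1).ne'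
  obtain ⟨K, hK, hKC⟩ := ((eventually_forall_add_mul_pos_of_isCompact isCompact_Icc hh hP
    hP_nonneg hpos_of_zero).and (eventually_ge_atTop (-C / (1 - δ)))).exists
  obtain ⟨k, hk, hkK⟩ := isCompact_Icc.exists_forall_le' (hh.fun_add (hP.const_mul K)) hK
  filter_upwards [self_mem_nhdsWithin, eventually_mul_lt_nhdsGT_zero (K + K ^ 2) hk]
    with D hD hsmall μ hμ u hu
  have huδ := hu.apply_lt_of_lt_potential (K := K) hD ⟨hδ.1.le, hδ.2⟩ fun x hx => by
    have := hkK x hx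
    linarith
  have : -C ≤ K * (1 - δ) := (div_le_iff₀ (sub_pos.2 hδ.2)).1 hKC
  linarith

lemma eventually_lt_eigenvalue_of_le_drift {α : ℝ} (hb : ContinuousOn b (Icc 0 1))
    (hV : ContinuousOn V (Icc 0 1)) (hb_pos : ∀ x ∈ Ioo (0 : ℝ) 1, 0 < b x) (hα : 0 ≤ α)
    (hbα : ∀ᶠ x in 𝓝[Icc 0 1] (0 : ℝ), α * x ≤ b x) (ha₀ : a < V 0 + α) (ha₁ : a < V 1) :
    ∀ᶠ D in 𝓝[>] (0 : ℝ), ∀ μ u, IsRiccatiSolution b V D μ u → a < μ := by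
  obtain ⟨δ, hδ, C, hC⟩ := exists_le_apply_of_le_drift
    (hV 0 (left_mem_Icc.2 zero_le_one)) hα hbα ha₀
  filter_upwards [self_mem_nhdsWithin,
    eventually_apply_lt_of_lt_potential_one hb hV hb_pos ha₁ hδ C] with D hD hlt μ u hu
  exact not_le.1 fun hμ => (hlt μ hμ u hu).not_ge (hC D hD μ hμ u hu)

end Thresholds

section LogDerivative

variable {m V φ : ℝ → ℝ} {D μ : ℝ}

lemma derivUnit_eq {f' : ℝ} {x : ℝ} {f : ℝ → ℝ} (hx : x ∈ Icc (0 : ℝ) 1)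
    (hf : HasDerivWithinAt f f' (Icc 0 1) x) : derivUnit f x = f' :=
  hf.derivWithin (uniqueDiffOn_Icc one_pos x hx)

lemma contDiffOn_derivUnit (hφ : ContDiffOn ℝ 2 φ (Icc 0 1)) :
    ContDiffOn ℝ 1 (derivUnit φ) (Icc 0 1) :=
  hφ.derivWithin (uniqueDiffOn_Icc one_pos) (by norm_num)

lemma contDiffOn_two_of_hasDerivWithinAt {s : Set ℝ} {f f' f'' : ℝ → ℝ} (hs : UniqueDiffOn ℝ s)
    (hf : ∀ x ∈ s, HasDerivWithinAt f (f' x) s x)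
    (hf' : ∀ x ∈ s, HasDerivWithinAt f' (f'' x) s x) (hf'' : ContinuousOn f'' s) :
    ContDiffOn ℝ 2 f s := by
  have hone : ContDiffOn ℝ 1 f' s :=
    (contDiffOn_one_iff_derivWithin hs).2 ⟨fun x hx => (hf' x hx).differentiableWithinAt,
      hf''.congr fun x hx => (hf' x hx).derivWithin (hs x hx)⟩
  exact (contDiffOn_succ_iff_derivWithin (n := 1) hs).2
    ⟨fun x hx => (hf x hx).differentiableWithinAt, by simp,
      hone.congr fun x hx => (hf x hx).derivWithin (hs x hx)⟩

lemma IsPositiveEigenfunction.hasDerivWithinAt_derivUnit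
    (hφ : IsPositiveEigenfunction m V D μ φ) (hD : D ≠ 0)
    (hm : ContinuousOn (derivUnit m) (Icc 0 1)) (hV : ContinuousOn V (Icc 0 1)) :
    ∀ x ∈ Icc (0 : ℝ) 1, HasDerivWithinAt (derivUnit φ)
      (((V x - μ) * φ x - derivUnit m x * derivUnit φ x) / D) (Icc 0 1) x := by
  have hC1 := contDiffOn_derivUnit hφ.contDiffOn
  have hφ' := hC1.continuousOn
  have hφ'' : ContinuousOn (derivUnit (derivUnit φ)) (Icc 0 1) :=
    hC1.continuousOn_derivWithin (uniqueDiffOn_Icc one_pos) le_rfl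
  have heq : EqOn (derivUnit (derivUnit φ))
      (fun x => ((V x - μ) * φ x - derivUnit m x * derivUnit φ x) / D) (Icc 0 1) := by
    refine EqOn.of_subset_closure (s := Ioo 0 1) (fun x hx => ?_) hφ''
      ((((hV.sub continuousOn_const).mul hφ.contDiffOn.continuousOn).sub
        (hm.mul hφ')).div_const D) Ioo_subset_Icc_self (closure_Ioo zero_ne_one).ge
    rw [eq_div_iff hD]
    linarith [hφ.equation x hx]
  intro x hx
  exact (hC1.differentiableOn one_ne_zero x hx).hasDerivWithinAt.congr_deriv (heq hx)

lemma IsPositiveEigenfunction.isRiccatiSolution (hφ : IsPositiveEigenfunction m V D μ φ)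
    (hD : D ≠ 0) (hm : ContinuousOn (derivUnit m) (Icc 0 1)) (hV : ContinuousOn V (Icc 0 1)) :
    IsRiccatiSolution (derivUnit m) V D μ (fun x => derivUnit φ x / φ x) where
  hasDerivWithinAt x hx := by
    have hφx : φ x ≠ 0 := (hφ.pos x hx).ne'
    have hφ' : HasDerivWithinAt φ (derivUnit φ x) (Icc 0 1) x :=
      (hφ.contDiffOn.differentiableOn two_ne_zero x hx).hasDerivWithinAt
    refine ((hφ.hasDerivWithinAt_derivUnit hD hm hV x hx).div hφ' hφx).congr_deriv ?_
    field_simp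
  zero := by simp [hφ.neumann_zero]
  one := by simp [hφ.neumann_one]

lemma IsRiccatiSolution.exists_isPositiveEigenfunction {u : ℝ → ℝ}
    (hu : IsRiccatiSolution (derivUnit m) V D μ u) (hD : D ≠ 0)
    (hm : ContinuousOn (derivUnit m) (Icc 0 1)) (hV : ContinuousOn V (Icc 0 1)) :
    ∃ φ, IsPositiveEigenfunction m V D μ φ := by
  have hu_cont : ContinuousOn u (Icc 0 1) := fun x hx =>
    (hu.hasDerivWithinAt x hx).continuousWithinAt
  obtain ⟨W, hW⟩ := exists_hasDerivWithinAt_Icc_of_continuousOn zero_le_one hu_cont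
  set φ : ℝ → ℝ := fun x => Real.exp (W x)
  set φ' : ℝ → ℝ := fun x => φ x * u x
  set φ'' : ℝ → ℝ := fun x => φ x * ((V x - μ - derivUnit m x * u x) / D)
  have hφ : ∀ x ∈ Icc (0 : ℝ) 1, HasDerivWithinAt φ (φ' x) (Icc 0 1) x :=
    fun x hx => (hW x hx).exp
  have hφ' : ∀ x ∈ Icc (0 : ℝ) 1, HasDerivWithinAt φ' (φ'' x) (Icc 0 1) x := fun x hx =>
    ((hφ x hx).mul (hu.hasDerivWithinAt x hx)).congr_deriv (by ring)
  have hφ_cont : ContinuousOn φ (Icc 0 1) := fun x hx => (hφ x hx).continuousWithinAt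
  have hφ'' : ContinuousOn φ'' (Icc 0 1) :=
    hφ_cont.mul (((hV.sub continuousOn_const).sub (hm.mul hu_cont)).div_const D)
  have hderiv : EqOn (derivUnit φ) φ' (Icc 0 1) := fun x hx => derivUnit_eq hx (hφ x hx)
  refine ⟨φ, ⟨contDiffOn_two_of_hasDerivWithinAt (uniqueDiffOn_Icc one_pos) hφ hφ' hφ'',
    fun x _ => Real.exp_pos _, fun x hx => ?_, ?_, ?_⟩⟩
  · have hxI := Ioo_subset_Icc_self hx
    have hderiv₂ : derivUnit (derivUnit φ) x = φ'' x :=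
      derivUnit_eq hxI ((hφ' x hxI).congr hderiv (hderiv hxI))
    rw [hderiv₂, hderiv hxI]
    simp only [φ', φ'']
    field_simp
    ring
  · simp [hderiv (left_mem_Icc.2 zero_le_one), φ', hu.zero]
  · simp [hderiv (right_mem_Icc.2 zero_le_one), φ', hu.one]

lemma isPrincipalEigenvalue_iff_exists_isRiccatiSolution (hD : D ≠ 0)
    (hm : ContinuousOn (derivUnit m) (Icc 0 1)) (hV : ContinuousOn V (Icc 0 1)) :
    IsPrincipalEigenvalue m V D μ ↔ ∃ u, IsRiccatiSolution (derivUnit m) V D μ u :=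
  ⟨fun ⟨_, hφ⟩ => ⟨_, hφ.isRiccatiSolution hD hm hV⟩,
    fun ⟨_, hu⟩ => hu.exists_isPositiveEigenfunction hD hm hV⟩

end LogDerivative

/-- The right-hand side of the equation `θ' = pruferField b V D μ x θ` for the Prüfer angle
`θ = arctan u` of a solution `u` of the Riccati equation. Unlike the latter, it is bounded and
globally Lipschitz in the unknown. -/
noncomputable def pruferField (b V : ℝ → ℝ) (D μ x θ : ℝ) : ℝ :=
  (V x - μ) / D * Real.cos θ ^ 2 - b x / D * (Real.sin θ * Real.cos θ) - Real.sin θ ^ 2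

section Prufer

open scoped NNReal

variable {b V : ℝ → ℝ} {D μ : ℝ}

lemma abs_pruferField_le (b V : ℝ → ℝ) (D μ x θ : ℝ) :
    |pruferField b V D μ x θ| ≤ |(V x - μ) / D| + |b x / D| + 1 := by
  have hcos : Real.cos θ ^ 2 ≤ 1 := Real.cos_sq_le_one θ
  have hsin : Real.sin θ ^ 2 ≤ 1 := Real.sin_sq_le_one θ
  have hmul : |Real.sin θ * Real.cos θ| ≤ 1 := by
    rw [abs_mul]
    exact mul_le_one₀ (Real.abs_sin_le_one θ) (abs_nonneg _) (Real.abs_cos_le_one θ)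
  calc |pruferField b V D μ x θ|
      ≤ |(V x - μ) / D * Real.cos θ ^ 2| + |b x / D * (Real.sin θ * Real.cos θ)|
          + |Real.sin θ ^ 2| := (abs_sub _ _).trans (by gcongr; exact abs_sub _ _)
    _ = |(V x - μ) / D| * Real.cos θ ^ 2 + |b x / D| * |Real.sin θ * Real.cos θ|
          + Real.sin θ ^ 2 := by simp only [abs_mul, abs_pow, sq_abs]
    _ ≤ |(V x - μ) / D| * 1 + |b x / D| * 1 + 1 := by gcongr
    _ = _ := by ring

lemma hasDerivAt_pruferField (b V : ℝ → ℝ) (D μ x θ : ℝ) :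
    HasDerivAt (pruferField b V D μ x)
      (-((V x - μ) / D) * Real.sin (2 * θ) - b x / D * Real.cos (2 * θ) - Real.sin (2 * θ)) θ := by
  have hcos := Real.hasDerivAt_cos θ
  have hsin := Real.hasDerivAt_sin θ
  refine ((((hcos.fun_pow 2).const_mul ((V x - μ) / D)).sub
    ((hsin.mul hcos).const_mul (b x / D))).sub (hsin.fun_pow 2)).congr_deriv ?_
  rw [Real.sin_two_mul, Real.cos_two_mul']
  push_cast
  ring

lemma lipschitzWith_pruferField {K : ℝ≥0} {x : ℝ}
    (hK : |(V x - μ) / D| + |b x / D| + 1 ≤ K) : LipschitzWith K (pruferField b V D μ x) := by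
  refine lipschitzWith_of_nnnorm_deriv_le
    (fun θ => (hasDerivAt_pruferField b V D μ x θ).differentiableAt) fun θ => ?_
  rw [(hasDerivAt_pruferField b V D μ x θ).deriv, ← NNReal.coe_le_coe, coe_nnnorm,
    Real.norm_eq_abs]
  have hsin := Real.abs_sin_le_one (2 * θ)
  have hcos := Real.abs_cos_le_one (2 * θ)
  refine le_trans ?_ hK
  calc _ ≤ |-((V x - μ) / D) * Real.sin (2 * θ)| + |b x / D * Real.cos (2 * θ)|
          + |Real.sin (2 * θ)| := (abs_sub _ _).trans (by gcongr; exact abs_sub _ _)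
    _ = |(V x - μ) / D| * |Real.sin (2 * θ)| + |b x / D| * |Real.cos (2 * θ)|
          + |Real.sin (2 * θ)| := by simp only [abs_mul, abs_neg]
    _ ≤ |(V x - μ) / D| * 1 + |b x / D| * 1 + 1 := by gcongr
    _ = _ := by ring

lemma dist_pruferField_le (b V : ℝ → ℝ) (D μ ν x θ : ℝ) :
    dist (pruferField b V D μ x θ) (pruferField b V D ν x θ) ≤ |D|⁻¹ * dist μ ν := by
  have : pruferField b V D μ x θ - pruferField b V D ν x θ = D⁻¹ * (ν - μ) * Real.cos θ ^ 2 := by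
    simp only [pruferField]
    ring
  rw [Real.dist_eq, this, dist_comm, Real.dist_eq, abs_mul, abs_mul, abs_inv, abs_sq]
  exact mul_le_of_le_one_right (by positivity) (Real.cos_sq_le_one θ)

lemma exists_prufer_angle (hb : ContinuousOn b (Icc 0 1)) (hV : ContinuousOn V (Icc 0 1)) (D : ℝ) :
    ∃ θ : ℝ → ℝ → ℝ, Continuous (θ · 1) ∧ ∀ μ, θ μ 0 = 0 ∧ ∀ x ∈ Icc (0 : ℝ) 1,
      HasDerivWithinAt (θ μ) (pruferField b V D μ x (θ μ x)) (Icc 0 1) x := by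
  have hbound : ∀ μ, ∃ K : ℝ≥0, ∀ x ∈ Icc (0 : ℝ) 1, |(V x - μ) / D| + |b x / D| + 1 ≤ K := by
    intro μ
    have hcont : ContinuousOn (fun x => |(V x - μ) / D| + |b x / D| + 1) (Icc 0 1) :=
      ((((hV.sub continuousOn_const).div_const D).abs).add (hb.div_const D).abs).add
        continuousOn_const
    obtain ⟨C, hC⟩ := isCompact_Icc.bddAbove_image hcont
    exact ⟨C.toNNReal, fun x hx => (hC (mem_image_of_mem _ hx)).trans (Real.le_coe_toNNReal C)⟩
  choose K hK using hbound
  have hlip : ∀ μ, ∀ x ∈ Icc (0 : ℝ) 1, LipschitzWith (K μ) (pruferField b V D μ x) :=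
    fun μ x hx => lipschitzWith_pruferField (hK μ x hx)
  have hcont : ∀ μ y, ContinuousOn (pruferField b V D μ · y) (Icc 0 1) := fun μ y =>
    ((((hV.sub continuousOn_const).div_const D).mul continuousOn_const).sub
      ((hb.div_const D).mul continuousOn_const)).sub continuousOn_const
  choose θ hθ₀ hθ using fun μ => exists_hasDerivWithinAt_Icc_of_lipschitzWith_of_bounded
    zero_le_one (hlip μ) (hcont μ)
    (fun x hx y => (abs_pruferField_le b V D μ x y).trans (hK μ x hx)) 0
  refine ⟨θ, ?_, fun μ => ⟨hθ₀ μ, hθ μ⟩⟩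
  exact continuous_of_forall_hasDerivWithinAt_Icc (C := ‖D‖₊⁻¹) hlip
    (fun μ ν x _ y => by simpa using dist_pruferField_le b V D μ ν x y) hθ hθ₀
    (right_mem_Icc.2 zero_le_one)

lemma isRiccatiSolution_tan {θ : ℝ → ℝ}
    (hθ : ∀ x ∈ Icc (0 : ℝ) 1,
      HasDerivWithinAt θ (pruferField b V D μ x (θ x)) (Icc 0 1) x)
    (hθ₀ : θ 0 = 0) (hθ₁ : θ 1 = 0) :
    IsRiccatiSolution b V D μ (fun x => Real.tan (θ x)) := by
  -- The angle decreases strictly at `±π / 2`, so it reaches neither when it starts and ends at `0`.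
  have hlt : ∀ x ∈ Icc (0 : ℝ) 1, θ x < Real.pi / 2 := by
    intro x hx
    rcases hx.1.eq_or_lt with rfl | hx0
    · simpa [hθ₀] using Real.pi_div_two_pos
    refine sub_pos.1 (pos_of_deriv_pos_at_zeros (f := fun y => Real.pi / 2 - θ y)
      (fun y hy => (hθ y hy).const_sub _) (fun y _ hy0 => ?_)
      (by simpa [hθ₀] using Real.pi_div_two_pos.le) x ⟨hx0, hx.2⟩)
    simp [pruferField, ← sub_eq_zero.1 hy0]
  have hgt : ∀ x ∈ Icc (0 : ℝ) 1, -(Real.pi / 2) < θ x := by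
    intro x hx
    rcases hx.2.eq_or_lt with rfl | hx1
    · simpa [hθ₁] using Real.pi_div_two_pos
    refine sub_neg.1 (neg_of_deriv_pos_at_zeros (f := fun y => -(Real.pi / 2) - θ y)
      (fun y hy => (hθ y hy).const_sub _) (fun y _ hy0 => ?_)
      (by simpa [hθ₁] using Real.pi_div_two_pos.le) x ⟨hx.1, hx1⟩)
    simp [pruferField, ← sub_eq_zero.1 hy0]
  refine ⟨fun x hx => ?_, by simp [hθ₀], by simp [hθ₁]⟩
  have hcos : Real.cos (θ x) ≠ 0 := (Real.cos_pos_of_mem_Ioo ⟨hgt x hx, hlt x hx⟩).ne'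
  refine ((Real.hasDerivAt_tan hcos).comp_hasDerivWithinAt x (hθ x hx)).congr_deriv ?_
  rw [pruferField, Real.tan_eq_sin_div_cos]
  field_simp

lemma exists_isRiccatiSolution (hb : ContinuousOn b (Icc 0 1)) (hV : ContinuousOn V (Icc 0 1))
    (hD : 0 < D) : ∃ μ u, IsRiccatiSolution b V D μ u := by
  obtain ⟨M, hM⟩ := isCompact_Icc.exists_bound_of_continuousOn hV
  obtain ⟨θ, hcont, hθ⟩ := exists_prufer_angle hb hV D
  have hlow : 0 ≤ θ (-M - 1) 1 := by
    refine (pos_of_deriv_pos_at_zeros (hθ _).2 (fun x hx hx0 => ?_) (hθ _).1.ge 1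
      ⟨one_pos, le_rfl⟩).le
    have : 0 < V x - (-M - 1) := by linarith [neg_le_of_abs_le (hM x hx)]
    simpa [pruferField, hx0] using div_pos this hD
  have hhigh : θ (M + 1) 1 ≤ 0 := by
    refine (neg_pos.1 (pos_of_deriv_pos_at_zeros (f := fun x => -θ (M + 1) x)
      (fun x hx => ((hθ _).2 x hx).fun_neg) (fun x hx hx0 => ?_)
      (by simp [(hθ _).1]) 1 ⟨one_pos, le_rfl⟩)).le
    have : V x - (M + 1) < 0 := by linarith [le_of_abs_le (hM x hx)]
    simpa [pruferField, neg_eq_zero.1 hx0] using div_neg_of_neg_of_pos this hD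
  obtain ⟨μ, hμ⟩ := mem_range_of_exists_le_of_exists_ge hcont ⟨_, hhigh⟩ ⟨_, hlow⟩
  exact ⟨μ, _, isRiccatiSolution_tan (hθ μ).2 (hθ μ).1 hμ⟩

end Prufer

section SecondDerivAtZero

variable {m : ℝ → ℝ}

lemma eventually_mul_le_of_lt_deriv {f : ℝ → ℝ} {s : Set ℝ} {α c : ℝ} (hs : s ⊆ Ici 0)
    (hf : HasDerivWithinAt f c s 0) (hf₀ : f 0 = 0) (hα : α < c) :
    ∀ᶠ x in 𝓝[s] 0, α * x ≤ f x := by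
  filter_upwards [(hasDerivWithinAt_iff_isLittleO.1 hf).def (sub_pos.2 hα), self_mem_nhdsWithin]
    with x hx hxs
  simp only [hf₀, sub_zero, smul_eq_mul, Real.norm_eq_abs, abs_of_nonneg (mem_Ici.1 (hs hxs))] at hx
  linarith [neg_le_of_abs_le hx]

lemma eventually_mul_le_derivUnit {α : ℝ} (hm : ContinuousWithinAt (derivUnit m) (Icc 0 1) 0)
    (hm₀ : derivUnit m 0 = 0 → DifferentiableWithinAt ℝ (derivUnit m) (Icc 0 1) 0)
    (hα : (α : EReal) < secondDerivAtZero m) :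
    ∀ᶠ x in 𝓝[Icc 0 1] (0 : ℝ), α * x ≤ derivUnit m x := by
  rcases lt_trichotomy (derivUnit m 0) 0 with hneg | hzero | hpos
  · simp [secondDerivAtZero, hneg, hneg.not_gt] at hα
  · simp only [secondDerivAtZero, hzero, lt_self_iff_false, if_false, EReal.coe_lt_coe_iff] at hα
    exact eventually_mul_le_of_lt_deriv Icc_subset_Ici_self (hm₀ hzero).hasDerivWithinAt
      hzero hα
  · have hlin : ContinuousWithinAt (fun x => α * x) (Icc 0 1) 0 := by fun_prop
    have : ∀ᶠ x in 𝓝[Icc 0 1] (0 : ℝ), α * x < derivUnit m x :=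
      hlin.eventually_lt hm (by simpa using hpos)
    exact this.mono fun _ => le_of_lt

lemma eventually_derivUnit_le_mul {β : ℝ} (hm : ContinuousWithinAt (derivUnit m) (Icc 0 1) 0)
    (hm₀ : derivUnit m 0 = 0 → DifferentiableWithinAt ℝ (derivUnit m) (Icc 0 1) 0)
    (hβ : secondDerivAtZero m < β) :
    ∀ᶠ x in 𝓝[Icc 0 1] (0 : ℝ), derivUnit m x ≤ β * x := by
  rcases lt_trichotomy (derivUnit m 0) 0 with hneg | hzero | hpos
  · have hlin : ContinuousWithinAt (fun x => β * x) (Icc 0 1) 0 := by fun_prop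
    have : ∀ᶠ x in 𝓝[Icc 0 1] (0 : ℝ), derivUnit m x < β * x :=
      hm.eventually_lt hlin (by simpa using hneg)
    exact this.mono fun _ => le_of_lt
  · simp only [secondDerivAtZero, hzero, lt_self_iff_false, if_false, EReal.coe_lt_coe_iff] at hβ
    have := eventually_mul_le_of_lt_deriv Icc_subset_Ici_self (hm₀ hzero).hasDerivWithinAt.neg
      (by simpa using hzero) (neg_lt_neg hβ)
    exact this.mono fun x hx => by simpa using hx
  · simp [secondDerivAtZero, hpos] at hβ

lemma exists_nonneg_mul_le_derivUnit {c : ℝ} (hm : ContinuousWithinAt (derivUnit m) (Icc 0 1) 0)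
    (hm₀ : derivUnit m 0 = 0 → DifferentiableWithinAt ℝ (derivUnit m) (Icc 0 1) 0)
    (hm_nonneg : ∀ x ∈ Icc (0 : ℝ) 1, 0 ≤ derivUnit m x)
    (hc : (c : EReal) < erealPosPart (secondDerivAtZero m)) :
    ∃ α, 0 ≤ α ∧ c < α ∧ ∀ᶠ x in 𝓝[Icc 0 1] (0 : ℝ), α * x ≤ derivUnit m x := by
  rcases lt_max_iff.1 hc with hc | hc
  · obtain ⟨α, hcα, hα⟩ := EReal.lt_iff_exists_real_btwn.1 hc
    refine ⟨max α 0, le_max_right _ _, lt_max_of_lt_left (EReal.coe_lt_coe_iff.1 hcα), ?_⟩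
    filter_upwards [eventually_mul_le_derivUnit hm hm₀ hα, self_mem_nhdsWithin] with x hx hxI
    rw [max_mul_of_nonneg _ _ hxI.1, zero_mul]
    exact max_le hx (hm_nonneg x hxI)
  · refine ⟨0, le_rfl, EReal.coe_lt_coe_iff.1 hc, ?_⟩
    filter_upwards [self_mem_nhdsWithin] with x hx
    simpa using hm_nonneg x hx

lemma exists_nonneg_derivUnit_le_mul {c : ℝ} (hm : ContinuousWithinAt (derivUnit m) (Icc 0 1) 0)
    (hm₀ : derivUnit m 0 = 0 → DifferentiableWithinAt ℝ (derivUnit m) (Icc 0 1) 0)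
    (hc : erealPosPart (secondDerivAtZero m) < c) :
    ∃ β, 0 ≤ β ∧ β < c ∧ ∀ᶠ x in 𝓝[Icc 0 1] (0 : ℝ), derivUnit m x ≤ β * x := by
  obtain ⟨β, hβ, hβc⟩ := EReal.lt_iff_exists_real_btwn.1 hc
  obtain ⟨hβ, hβ_pos⟩ := max_lt_iff.1 hβ
  exact ⟨β, (EReal.coe_pos.1 hβ_pos).le, EReal.coe_lt_coe_iff.1 hβc,
    eventually_derivUnit_le_mul hm hm₀ hβ⟩

end SecondDerivAtZero

section PrincipalEigenvalue

variable {m V : ℝ → ℝ} {a : ℝ}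

lemma existsUnique_isPrincipalEigenvalue {D : ℝ} (hD : 0 < D)
    (hm : ContinuousOn (derivUnit m) (Icc 0 1)) (hV : ContinuousOn V (Icc 0 1)) :
    ∃! μ, IsPrincipalEigenvalue m V D μ := by
  simp only [isPrincipalEigenvalue_iff_exists_isRiccatiSolution hD.ne' hm hV]
  obtain ⟨μ, u, hu⟩ := exists_isRiccatiSolution hm hV hD
  exact ⟨μ, ⟨u, hu⟩, fun _ ⟨_, hv⟩ => hv.eigenvalue_unique hD hu⟩

lemma eventually_isPrincipalEigenvalue_imp {P : ℝ → Prop}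
    (hm : ContinuousOn (derivUnit m) (Icc 0 1)) (hV : ContinuousOn V (Icc 0 1))
    (h : ∀ᶠ D in 𝓝[>] (0 : ℝ), ∀ μ u, IsRiccatiSolution (derivUnit m) V D μ u → P μ) :
    ∀ᶠ D in 𝓝[>] (0 : ℝ), ∀ μ, IsPrincipalEigenvalue m V D μ → P μ := by
  filter_upwards [self_mem_nhdsWithin, h] with D hD hP μ hμ
  obtain ⟨u, hu⟩ := (isPrincipalEigenvalue_iff_exists_isRiccatiSolution
    (mem_Ioi.1 hD).ne' hm hV).1 hμ
  exact hP μ u hu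

lemma eventually_lt_principalEigenvalue (hm : ContinuousOn (derivUnit m) (Icc 0 1))
    (hm₀ : derivUnit m 0 = 0 → DifferentiableWithinAt ℝ (derivUnit m) (Icc 0 1) 0)
    (hV : ContinuousOn V (Icc 0 1)) (hm_pos : ∀ x ∈ Ioo (0 : ℝ) 1, 0 < derivUnit m x)
    (ha : (a : EReal) < min ((V 0 : EReal) + erealPosPart (secondDerivAtZero m)) (V 1)) :
    ∀ᶠ D in 𝓝[>] (0 : ℝ), ∀ μ, IsPrincipalEigenvalue m V D μ → a < μ := by
  obtain ⟨ha₀, ha₁⟩ := lt_min_iff.1 ha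
  have hm_nonneg := nonneg_on_Icc_of_nonneg_on_Ioo one_pos hm fun x hx => (hm_pos x hx).le
  have hc : ((a - V 0 : ℝ) : EReal) < erealPosPart (secondDerivAtZero m) := by
    rw [EReal.coe_sub]
    exact EReal.sub_lt_of_lt_add' ha₀
  obtain ⟨α, hα, hcα, hbα⟩ := exists_nonneg_mul_le_derivUnit
    (hm 0 (left_mem_Icc.2 zero_le_one)) hm₀ hm_nonneg hc
  exact eventually_isPrincipalEigenvalue_imp hm hV <| eventually_lt_eigenvalue_of_le_drift hm hV
    hm_pos hα hbα (sub_lt_iff_lt_add'.1 hcα) (EReal.coe_lt_coe_iff.1 ha₁)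

lemma eventually_principalEigenvalue_lt (hm : ContinuousOn (derivUnit m) (Icc 0 1))
    (hm₀ : derivUnit m 0 = 0 → DifferentiableWithinAt ℝ (derivUnit m) (Icc 0 1) 0)
    (hV : ContinuousOn V (Icc 0 1)) (hm_pos : ∀ x ∈ Ioo (0 : ℝ) 1, 0 < derivUnit m x)
    (ha : min ((V 0 : EReal) + erealPosPart (secondDerivAtZero m)) (V 1) < (a : EReal)) :
    ∀ᶠ D in 𝓝[>] (0 : ℝ), ∀ μ, IsPrincipalEigenvalue m V D μ → μ < a := by
  refine eventually_isPrincipalEigenvalue_imp hm hV ?_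
  have h₀ : (0 : ℝ) ∈ Icc (0 : ℝ) 1 := left_mem_Icc.2 zero_le_one
  have h₁ : (1 : ℝ) ∈ Icc (0 : ℝ) 1 := right_mem_Icc.2 zero_le_one
  rcases min_lt_iff.1 ha with ha₀ | ha₁
  · have hc : erealPosPart (secondDerivAtZero m) < ((a - V 0 : ℝ) : EReal) := by
      rw [EReal.coe_sub, EReal.lt_sub_iff_add_lt (.inl (EReal.coe_ne_bot _))
        (.inl (EReal.coe_ne_top _)), add_comm]
      exact ha₀
    obtain ⟨β, hβ, hβc, hbβ⟩ := exists_nonneg_derivUnit_le_mul (hm 0 h₀) hm₀ hc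
    exact eventually_eigenvalue_lt_of_drift_le (hV 0 h₀) hβ hbβ (lt_sub_iff_add_lt'.1 hβc)
  · exact eventually_eigenvalue_lt_of_potential_one_lt (hV 1 h₁)
      (nonneg_on_Icc_of_nonneg_on_Ioo one_pos hm fun x hx => (hm_pos x hx).le)
      (EReal.coe_lt_coe_iff.1 ha₁)

end PrincipalEigenvalue

theorem corollary2p5_general (m V : ℝ → ℝ)
    (hm : ContDiffOn ℝ 1 m (Icc (0 : ℝ) 1))
    (hm₀ : derivUnit m 0 = 0 → DifferentiableWithinAt ℝ (derivUnit m) (Icc (0 : ℝ) 1) 0)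
    (hV : ContinuousOn V (Icc (0 : ℝ) 1))
    (hm_pos : ∀ x ∈ Ioo (0 : ℝ) 1, 0 < derivUnit m x) :
    (∀ D : ℝ, 0 < D → ∃! μ : ℝ, IsPrincipalEigenvalue m V D μ) ∧
    ∀ lam : ℝ → ℝ, (∀ D : ℝ, 0 < D → IsPrincipalEigenvalue m V D (lam D)) →
      Tendsto (fun D : ℝ => ((lam D : ℝ) : EReal)) (𝓝[>] (0 : ℝ))
        (𝓝 (min ((V 0 : EReal) + erealPosPart (secondDerivAtZero m)) (V 1 : EReal))) := by
  have hm' : ContinuousOn (derivUnit m) (Icc 0 1) :=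
    hm.continuousOn_derivWithin (uniqueDiffOn_Icc one_pos) le_rfl
  refine ⟨fun D hD => existsUnique_isPrincipalEigenvalue hD hm' hV, fun lam hlam => ?_⟩
  refine tendsto_order.2 ⟨fun a ha => ?_, fun a ha => ?_⟩
  · obtain ⟨r, har, hr⟩ := EReal.lt_iff_exists_real_btwn.1 ha
    filter_upwards [self_mem_nhdsWithin,
      eventually_lt_principalEigenvalue hm' hm₀ hV hm_pos hr] with D hD hlt
    exact har.trans (EReal.coe_lt_coe_iff.2 (hlt _ (hlam D hD)))
  · obtain ⟨r, hr, hra⟩ := EReal.lt_iff_exists_real_btwn.1 ha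
    filter_upwards [self_mem_nhdsWithin,
      eventually_principalEigenvalue_lt hm' hm₀ hV hm_pos hr] with D hD hlt
    exact (EReal.coe_lt_coe_iff.2 (hlt _ (hlam D hD))).trans hra

theorem corollary2p5 (m V : ℝ → ℝ)
    (hm : ContDiffOn ℝ 2 m (Icc (0 : ℝ) 1))
    (hV : ContinuousOn V (Icc (0 : ℝ) 1))
    (hm_pos : ∀ x ∈ Ioo (0 : ℝ) 1, 0 < derivUnit m x) :
    (∀ D : ℝ, 0 < D → ∃! μ : ℝ, IsPrincipalEigenvalue m V D μ) ∧
    ∀ lam : ℝ → ℝ, (∀ D : ℝ, 0 < D → IsPrincipalEigenvalue m V D (lam D)) →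
      Tendsto (fun D : ℝ => ((lam D : ℝ) : EReal)) (𝓝[>] (0 : ℝ))
        (𝓝 (min ((V 0 : EReal) + erealPosPart (secondDerivAtZero m)) (V 1 : EReal))) :=
  corollary2p5_general m V (hm.of_le one_le_two)
    (fun _ => (contDiffOn_derivUnit hm).differentiableOn one_ne_zero 0 (left_mem_Icc.2 zero_le_one))
    hV hm_pos
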